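/- Let $n\ge 1$ and let $p<-n$ be real. Consider $\mathbb{R}^n$ with density $r^p$, where $r=|x|$: a Lebesgue measurable set $E\subseteq\mathbb{R}^n$ has weighted volume $V(E)=\int_E |x|^p\,dx\in[0,\infty]$ and weighted perimeter $$P(E)=\sup\Big\{\int_E \operatorname{div}\big(|x|^pX\big)\,dx \;:\; X\in C^1_c(\mathbb{R}^n\setminus\{0\};\mathbb{R}^n),\ |X|\le 1\Big\}\in[0,\infty],$$ which for regions bounded by sufficiently regular hypersurfaces is the integral of $|x|^p$ over the boundary with respect to hypersurface area. A measurable set is called isoperimetric if its weighted perimeter is least among all measurable sets of the same weighted volume. Then hyperspheres about the origin, bounding volume away from the origin, are uniquely isoperimetric. That is: (a) for every $R>0$ the set $A_R=\{x\in\mathbb{R}^n:|x|>R\}$ has finite positive weighted volume and is isoperimetric, and every isoperimetric set of the same weighted volume coincides with $A_R$ up to a set of Lebesgue measure zero; (b) for every $V\in(0,\infty)$ there is exactly one $R>0$ such that $A_R$ has weighted volume $V$. -/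

import Mathlib

open MeasureTheory
open scoped ENNReal

noncomputable section

namespace RadialDensity

/-- The weighted volume `∫_E |x|^p dx` of a set `E` in `ℝⁿ` with density `r^p`. (The value of the
density at the origin is irrelevant in dimension `n ≥ 1`, the origin being Lebesgue null.) -/
def weightedVolume {n : ℕ} (p : ℝ) (E : Set (EuclideanSpace ℝ (Fin n))) : ℝ≥0∞ :=
  ∫⁻ x in E, ENNReal.ofReal (‖x‖ ^ p)

/-- The divergence `∑ᵢ ∂ᵢ Yᵢ` of a vector field on `ℝⁿ`. -/
def divergence {n : ℕ} (Y : EuclideanSpace ℝ (Fin n) → EuclideanSpace ℝ (Fin n))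
    (x : EuclideanSpace ℝ (Fin n)) : ℝ :=
  ∑ i, (fderiv ℝ Y x (EuclideanSpace.single i 1)) i

/-- Admissible test fields: `C¹` vector fields `X` with `|X| ≤ 1` and compact support
contained in `ℝⁿ ∖ {0}`, the open set on which the density `r^p` is smooth and positive. -/
structure IsTestField {n : ℕ}
    (X : EuclideanSpace ℝ (Fin n) → EuclideanSpace ℝ (Fin n)) : Prop where
  contDiff : ContDiff ℝ 1 X
  hasCompactSupport : HasCompactSupport X
  zero_notMem : (0 : EuclideanSpace ℝ (Fin n)) ∉ tsupport X
  norm_le_one : ∀ x, ‖X x‖ ≤ 1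

/-- The weighted perimeter, in the sense of De Giorgi, of `E` in `ℝⁿ` with density `r^p`:
`P(E) = sup { ∫_E div (|x|^p X) dx : X a test field } ∈ [0, ∞]`.
For a region bounded by nice hypersurfaces this is the integral of `|x|^p` over the boundary
with respect to hypersurface area. The field `X = 0` contributes `0`, so cutting negative integrals
off at `0` does not change the supremum. -/
def weightedPerimeter {n : ℕ} (p : ℝ) (E : Set (EuclideanSpace ℝ (Fin n))) : ℝ≥0∞ :=
  ⨆ (X : EuclideanSpace ℝ (Fin n) → EuclideanSpace ℝ (Fin n)) (_ : IsTestField X),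
    ENNReal.ofReal (∫ x in E, divergence (fun y => ‖y‖ ^ p • X y) x)

/-- `A` is isoperimetric in `ℝⁿ` with density `r^p`: it has least weighted perimeter among all
(Lebesgue measurable) sets of the same weighted volume. -/
structure IsIsoperimetric {n : ℕ} (p : ℝ) (A : Set (EuclideanSpace ℝ (Fin n))) : Prop where
  nullMeasurableSet : NullMeasurableSet A volume
  perimeter_le : ∀ E : Set (EuclideanSpace ℝ (Fin n)), NullMeasurableSet E volume →
    weightedVolume p E = weightedVolume p A → weightedPerimeter p A ≤ weightedPerimeter p E

/-- The region bounded by the hypersphere of radius `R` about the origin, on the side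
away from the origin. -/
def sphereExterior (n : ℕ) (R : ℝ) : Set (EuclideanSpace ℝ (Fin n)) :=
  {x | R < ‖x‖}

end RadialDensity

end

/-!
Write `r = |x|`. The unit radial field `X = -x / r` is a calibration: since `p < -n`, the divergence
`div (r^p X) = (1 - (p + n)) r^(p - 1)` is positive, and its ratio to the density `r^p` is
`(1 - (p + n)) / r`, a strictly decreasing function of `r`. Let `A` be the exterior of a sphere and
`E` a set of the same weighted volume. Then

  `P(E) ≥ ∫_E div (r^p X) ≥ ∫_A div (r^p X) = P(A)`.

The middle inequality is the bathtub principle (`bathtub`), because `A` collects exactly the points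
where the ratio is smallest. Equality there forces `E` to contain `A` up to a null set, hence to
agree with `A` up to a null set, the two volumes being equal and finite.

The first inequality is `lintegral_le_weightedPerimeter`. As `X` is singular at the origin and not
compactly supported, it is replaced by the test fields `-(χ(log r / K) / (r + δ)) x` with a bump
function `χ`. Cutting off in the variable `log r` makes the error at most a constant over `K δ`
times the weighted volume of `E`, and Fatou's lemma gives the limit.

Of the last equality only `P(A) ≤ ∫_A div (r^p X)` is needed. Both sides are compared with the
weighted area of the sphere, by `weightedPerimeter_sphereExterior_le` and
`lintegral_divergence_sphereExterior`. The first of these is the divergence theorem outside a ball: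
the indicator of `A` is smoothed to a function of `r`, the derivative is moved from the test field
to it, and polar coordinates show that the resulting layer integral is at most the area, because
`r^(p + n - 1)` is decreasing.
-/

namespace RadialDensity

open Filter Topology Set

/-! ### Divergence of products and of radial fields -/

theorem sum_clm_apply_single_mul {n : ℕ} (L : EuclideanSpace ℝ (Fin n) →L[ℝ] ℝ)
    (v : EuclideanSpace ℝ (Fin n)) :
    ∑ i, L (EuclideanSpace.single i 1) * v i = L v := by
  conv_rhs => rw [← (EuclideanSpace.basisFun (Fin n) ℝ).sum_repr v]
  simp [mul_comm]

theorem divergence_smul {n : ℕ} {f : EuclideanSpace ℝ (Fin n) → ℝ}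
    {Y : EuclideanSpace ℝ (Fin n) → EuclideanSpace ℝ (Fin n)} {x : EuclideanSpace ℝ (Fin n)}
    (hf : DifferentiableAt ℝ f x) (hY : DifferentiableAt ℝ Y x) :
    divergence (fun y => f y • Y y) x = f x * divergence Y x + fderiv ℝ f x (Y x) := by
  unfold divergence
  rw [fderiv_fun_smul hf hY, ← sum_clm_apply_single_mul (fderiv ℝ f x), Finset.mul_sum,
    ← Finset.sum_add_distrib]
  simp

theorem divergence_id {n : ℕ} (x : EuclideanSpace ℝ (Fin n)) :
    divergence (fun y => y) x = n := by
  simp [divergence]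

theorem hasFDerivAt_comp_norm {n : ℕ} {g : ℝ → ℝ} {g' : ℝ} {x : EuclideanSpace ℝ (Fin n)}
    (hx : x ≠ 0) (hg : HasDerivAt g g' ‖x‖) :
    HasFDerivAt (fun y : EuclideanSpace ℝ (Fin n) => g ‖y‖) ((g' / ‖x‖) • innerSL ℝ x) x := by
  have hx' : 0 < ‖x‖ := norm_pos_iff.mpr hx
  have h1 := (hasStrictFDerivAt_norm_sq x).hasFDerivAt.sqrt (by positivity)
  simp only [Real.sqrt_sq (norm_nonneg _)] at h1
  refine (hg.comp_hasFDerivAt x h1).congr_fderiv ?_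
  ext v
  simp
  field_simp

theorem divergence_radial {n : ℕ} {g : ℝ → ℝ} {g' : ℝ} {x : EuclideanSpace ℝ (Fin n)}
    (hx : x ≠ 0) (hg : HasDerivAt g g' ‖x‖) :
    divergence (fun y : EuclideanSpace ℝ (Fin n) => g ‖y‖ • y) x = n * g ‖x‖ + ‖x‖ * g' := by
  have hx' : 0 < ‖x‖ := norm_pos_iff.mpr hx
  have h := hasFDerivAt_comp_norm hx hg
  rw [divergence_smul h.differentiableAt differentiableAt_fun_id, divergence_id, h.fderiv]
  simp
  field_simp

/-- The norm is singular only at the origin, where the field is assumed to vanish locally. -/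
theorem contDiff_comp_norm_smul {n : ℕ} {g : ℝ → ℝ}
    {X : EuclideanSpace ℝ (Fin n) → EuclideanSpace ℝ (Fin n)}
    (hg : ∀ r, 0 < r → ContDiffAt ℝ 1 g r) (hX : ContDiff ℝ 1 X)
    (h0 : (fun y => g ‖y‖ • X y) =ᶠ[𝓝 0] 0) :
    ContDiff ℝ 1 (fun y => g ‖y‖ • X y) := by
  rw [contDiff_iff_contDiffAt]
  intro x
  by_cases hx : x = 0
  · subst hx
    exact (contDiffAt_const (c := 0)).congr_of_eventuallyEq h0
  · exact ((hg _ (norm_pos_iff.mpr hx)).comp x (contDiffAt_norm ℝ hx)).smul hX.contDiffAt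

/-! ### The divergence theorem for compactly supported fields -/

theorem continuous_divergence {n : ℕ} {Y : EuclideanSpace ℝ (Fin n) → EuclideanSpace ℝ (Fin n)}
    (hY : ContDiff ℝ 1 Y) : Continuous (divergence Y) := by
  have := hY.continuous_fderiv one_ne_zero
  unfold divergence
  fun_prop

theorem integrable_divergence {n : ℕ} {Y : EuclideanSpace ℝ (Fin n) → EuclideanSpace ℝ (Fin n)}
    (hY : ContDiff ℝ 1 Y) (hc : HasCompactSupport Y) : Integrable (divergence Y) := by
  refine (continuous_divergence hY).integrable_of_hasCompactSupport ?_
  refine (hc.fderiv ℝ).mono fun x hx => ?_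
  contrapose! hx
  simp only [Function.mem_support, not_not] at hx ⊢
  simp [divergence, hx]

theorem integral_divergence_eq_zero {n : ℕ}
    {Y : EuclideanSpace ℝ (Fin n) → EuclideanSpace ℝ (Fin n)}
    (hY : ContDiff ℝ 1 Y) (hc : HasCompactSupport Y) : ∫ x, divergence Y x = 0 := by
  have hcont := hY.continuous_fderiv one_ne_zero
  have hint : ∀ v, Integrable fun x => fderiv ℝ Y x v := fun v =>
    (by fun_prop : Continuous fun x => fderiv ℝ Y x v).integrable_of_hasCompactSupport
      ((hc.fderiv ℝ).mono fun x hx => by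
        contrapose! hx
        simp only [Function.mem_support, not_not] at hx ⊢
        simp [hx])
  have hzero : ∀ v, ∫ x, fderiv ℝ Y x v = 0 := fun v => by
    have := integral_smul_fderiv_eq_neg_fderiv_smul_of_integrable (𝕜 := ℝ) (μ := volume)
      (f := fun _ : EuclideanSpace ℝ (Fin n) => (1 : ℝ)) (g := Y) (v := v)
      (by simp) (by simpa using hint v)
      (by simpa using hY.continuous.integrable_of_hasCompactSupport hc)
      (fun _ _ => differentiableAt_const _) (fun x _ => hY.differentiable one_ne_zero x)
    simpa using this
  unfold divergence
  have hcoord : ∀ i, Integrable fun x => (fderiv ℝ Y x (EuclideanSpace.single i 1)) i := fun i =>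
    (EuclideanSpace.proj i : EuclideanSpace ℝ (Fin n) →L[ℝ] ℝ).integrable_comp (hint _)
  rw [integral_finsetSum _ fun i _ => hcoord i]
  refine Finset.sum_eq_zero fun i _ => ?_
  have := (EuclideanSpace.proj i : EuclideanSpace ℝ (Fin n) →L[ℝ] ℝ).integral_comp_comm
    (hint (EuclideanSpace.single i 1))
  simpa [hzero] using this

/-! ### Weighted test fields -/

theorem contDiffAt_rpow_of_pos (p : ℝ) (r : ℝ) (hr : 0 < r) :
    ContDiffAt ℝ 1 (fun t : ℝ => t ^ p) r :=
  Real.contDiffAt_rpow_const_of_ne hr.ne'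

theorem IsTestField.eventuallyEq_zero {n : ℕ}
    {X : EuclideanSpace ℝ (Fin n) → EuclideanSpace ℝ (Fin n)} (hX : IsTestField X) :
    X =ᶠ[𝓝 0] 0 :=
  notMem_tsupport_iff_eventuallyEq.mp hX.zero_notMem

theorem IsTestField.contDiff_smul {n : ℕ}
    {X : EuclideanSpace ℝ (Fin n) → EuclideanSpace ℝ (Fin n)} (hX : IsTestField X) {g : ℝ → ℝ}
    (hg : ∀ r, 0 < r → ContDiffAt ℝ 1 g r) : ContDiff ℝ 1 fun y => g ‖y‖ • X y :=
  contDiff_comp_norm_smul hg hX.contDiff <| by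
    filter_upwards [hX.eventuallyEq_zero] with y hy
    simp [hy]

theorem IsTestField.hasCompactSupport_smul {n : ℕ}
    {X : EuclideanSpace ℝ (Fin n) → EuclideanSpace ℝ (Fin n)} (hX : IsTestField X)
    (g : EuclideanSpace ℝ (Fin n) → ℝ) : HasCompactSupport fun y => g y • X y :=
  HasCompactSupport.smul_left (f := g) (f' := X) hX.hasCompactSupport

/-! ### Integrals of radial functions -/

/-- The area of the unit sphere of `ℝⁿ`, as `n` times the volume of the unit ball. -/
noncomputable def unitSphereArea (n : ℕ) : ℝ :=
  n * volume.real (Metric.ball (0 : EuclideanSpace ℝ (Fin n)) 1)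

theorem unitSphereArea_pos {n : ℕ} (hn : 1 ≤ n) : 0 < unitSphereArea n := by
  have h : 0 < volume.real (Metric.ball (0 : EuclideanSpace ℝ (Fin n)) 1) :=
    ENNReal.toReal_pos (Metric.measure_ball_pos volume _ one_pos).ne' measure_ball_lt_top.ne
  have : (0 : ℝ) < n := by exact_mod_cast hn
  unfold unitSphereArea
  positivity

theorem integral_comp_norm {n : ℕ} (hn : 1 ≤ n) (f : ℝ → ℝ) :
    ∫ x : EuclideanSpace ℝ (Fin n), f ‖x‖
      = unitSphereArea n * ∫ y in Ioi (0 : ℝ), y ^ (n - 1) * f y := by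
  have : Nonempty (Fin n) := ⟨⟨0, hn⟩⟩
  rw [integral_fun_norm_addHaar]
  simp [unitSphereArea, mul_assoc]

theorem integrable_comp_norm_iff {n : ℕ} (hn : 1 ≤ n) {f : ℝ → ℝ} :
    Integrable (fun x : EuclideanSpace ℝ (Fin n) => f ‖x‖)
      ↔ IntegrableOn (fun y : ℝ => y ^ (n - 1) * f y) (Ioi 0) := by
  have : Nonempty (Fin n) := ⟨⟨0, hn⟩⟩
  rw [integrable_fun_norm_addHaar]
  simp

theorem pow_pred_mul_rpow {n : ℕ} (hn : 1 ≤ n) (p : ℝ) {y : ℝ} (hy : 0 < y) :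
    y ^ (n - 1) * y ^ p = y ^ (p + n - 1) := by
  rw [← Real.rpow_natCast, ← Real.rpow_add hy, Nat.cast_sub hn]
  congr 1
  push_cast
  ring

theorem measurableSet_sphereExterior (n : ℕ) (R : ℝ) : MeasurableSet (sphereExterior n R) :=
  measurableSet_lt measurable_const measurable_norm

theorem indicator_sphereExterior {n : ℕ} (R : ℝ) (f : ℝ → ℝ) :
    (sphereExterior n R).indicator (fun x => f ‖x‖) = fun x => (Ioi R).indicator f ‖x‖ := rfl

theorem integrableOn_rpow_norm_sphereExterior {n : ℕ} (hn : 1 ≤ n) {p R : ℝ} (hp : p < -(n : ℝ))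
    (hR : 0 < R) :
    IntegrableOn (fun x : EuclideanSpace ℝ (Fin n) => ‖x‖ ^ p) (sphereExterior n R) := by
  rw [← integrable_indicator_iff (measurableSet_sphereExterior n R),
    indicator_sphereExterior R (fun t => t ^ p), integrable_comp_norm_iff hn]
  have h := integrableOn_Ioi_rpow_of_lt (show p + n - 1 < -1 by linarith) hR
  rw [← integrable_indicator_iff measurableSet_Ioi] at h
  refine h.integrableOn.congr_fun (fun y hy => ?_) measurableSet_Ioi
  by_cases hyR : y ∈ Ioi R
  · simp only [indicator_of_mem hyR, pow_pred_mul_rpow hn p hy]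
  · simp only [indicator_of_notMem hyR, mul_zero]

theorem integral_rpow_norm_sphereExterior {n : ℕ} (hn : 1 ≤ n) {p R : ℝ} (hp : p < -(n : ℝ))
    (hR : 0 < R) :
    ∫ x in sphereExterior n R, ‖x‖ ^ p = unitSphereArea n * (R ^ (p + n) / (-(p + n))) := by
  rw [← integral_indicator (measurableSet_sphereExterior n R),
    indicator_sphereExterior R (fun t => t ^ p), integral_comp_norm hn]
  congr 1
  have h : ∀ y ∈ Ioi (0 : ℝ), y ^ (n - 1) * (Ioi R).indicator (fun t => t ^ p) y
      = (Ioi R).indicator (fun t => t ^ (p + n - 1)) y := fun y hy => by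
    by_cases hyR : y ∈ Ioi R
    · simp only [indicator_of_mem hyR, pow_pred_mul_rpow hn p hy]
    · simp only [indicator_of_notMem hyR, mul_zero]
  rw [setIntegral_congr_fun measurableSet_Ioi h, setIntegral_indicator measurableSet_Ioi,
    inter_eq_right.mpr (Ioi_subset_Ioi hR.le),
    integral_Ioi_rpow_of_lt (show p + n - 1 < -1 by linarith) hR, sub_add_cancel, neg_div, div_neg]

/-! ### The perimeter of the exterior of a sphere is at most its area -/

/-- A smooth monotone profile that vanishes for `t ≤ R` and equals `1` for
`t ≥ R + 1 / (j + 1)`. -/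
noncomputable def stepProfile (R : ℝ) (j : ℕ) (t : ℝ) : ℝ :=
  Real.smoothTransition ((j + 1) * (t - R))

theorem contDiff_stepProfile (R : ℝ) (j : ℕ) : ContDiff ℝ 1 (stepProfile R j) :=
  Real.smoothTransition.contDiff.comp (by fun_prop)

theorem monotone_stepProfile (R : ℝ) (j : ℕ) : Monotone (stepProfile R j) := fun s t h =>
  Real.smoothTransition.monotone (by gcongr)

theorem stepProfile_of_le {R t : ℝ} (j : ℕ) (h : t ≤ R) : stepProfile R j t = 0 :=
  Real.smoothTransition.zero_of_nonpos
    (mul_nonpos_of_nonneg_of_nonpos (by positivity) (by linarith))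

theorem norm_stepProfile_le_one (R : ℝ) (j : ℕ) (t : ℝ) : ‖stepProfile R j t‖ ≤ 1 := by
  unfold stepProfile
  rw [Real.norm_of_nonneg (Real.smoothTransition.nonneg _)]
  exact Real.smoothTransition.le_one _

theorem eventually_stepProfile_eq_one {R t : ℝ} (h : R < t) :
    ∀ᶠ j in atTop, stepProfile R j t = 1 := by
  obtain ⟨N, hN⟩ := exists_nat_gt (1 / (t - R))
  filter_upwards [eventually_ge_atTop N] with j hj
  refine Real.smoothTransition.one_of_one_le ?_
  have h0 : 0 < t - R := by linarith
  rw [div_lt_iff₀ h0] at hN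
  have : (N : ℝ) ≤ j := by exact_mod_cast hj
  nlinarith

theorem deriv_stepProfile_of_lt {R t : ℝ} (j : ℕ) (h : t < R) : deriv (stepProfile R j) t = 0 := by
  have : stepProfile R j =ᶠ[𝓝 t] fun _ => 0 := by
    filter_upwards [Iio_mem_nhds h] with s hs using stepProfile_of_le j (le_of_lt hs)
  rw [this.deriv_eq, deriv_const]

theorem integrable_deriv_stepProfile {R : ℝ} (hR : 0 < R) (j : ℕ) :
    IntegrableOn (deriv (stepProfile R j)) (Ioi 0) ∧
      ∫ t in Ioi 0, deriv (stepProfile R j) t = 1 := by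
  have hd : ∀ t ∈ Ici (0 : ℝ), HasDerivAt (stepProfile R j) (deriv (stepProfile R j) t) t :=
    fun t _ => ((contDiff_stepProfile R j).differentiable one_ne_zero t).hasDerivAt
  have hnn : ∀ t ∈ Ioi (0 : ℝ), 0 ≤ deriv (stepProfile R j) t :=
    fun t _ => (monotone_stepProfile R j).deriv_nonneg
  have hlim : Tendsto (stepProfile R j) atTop (𝓝 1) := by
    refine tendsto_const_nhds.congr' ?_
    filter_upwards [eventually_ge_atTop (R + 1)] with t ht
    refine (Real.smoothTransition.one_of_one_le ?_).symm
    nlinarith [(Nat.cast_nonneg j : (0 : ℝ) ≤ j)]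
  refine ⟨integrableOn_Ioi_deriv_of_nonneg' hd hnn hlim, ?_⟩
  rw [integral_Ioi_of_hasDerivAt_of_nonneg' hd hnn hlim, stepProfile_of_le j hR.le, sub_zero]

/-- The layer integral `∫ ψ'(|x|) |x|^p dx` is an average, with weight `ψ'`, of the weighted areas
of the spheres of radius `≥ R`, and these areas decrease with the radius. -/
theorem integral_deriv_stepProfile_le {n : ℕ} (hn : 1 ≤ n) {p R : ℝ} (hp : p < -(n : ℝ))
    (hR : 0 < R) (j : ℕ) :
    Integrable (fun x : EuclideanSpace ℝ (Fin n) => deriv (stepProfile R j) ‖x‖ * ‖x‖ ^ p) ∧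
    ∫ x : EuclideanSpace ℝ (Fin n), deriv (stepProfile R j) ‖x‖ * ‖x‖ ^ p
      ≤ unitSphereArea n * R ^ (p + n - 1) := by
  obtain ⟨hi, h1⟩ := integrable_deriv_stepProfile hR j
  have hnn : ∀ t, 0 ≤ deriv (stepProfile R j) t := fun t => (monotone_stepProfile R j).deriv_nonneg
  have hle : ∀ t ∈ Ioi (0 : ℝ), t ^ (n - 1) * (deriv (stepProfile R j) t * t ^ p)
      ≤ R ^ (p + n - 1) * deriv (stepProfile R j) t := fun t (ht : 0 < t) => by
    rw [mul_left_comm, pow_pred_mul_rpow hn p ht, mul_comm]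
    rcases lt_or_ge t R with h | h
    · simp [deriv_stepProfile_of_lt j h]
    · exact mul_le_mul_of_nonneg_right
        (Real.rpow_le_rpow_of_nonpos hR h (by linarith)) (hnn t)
  have hint : IntegrableOn
      (fun t : ℝ => t ^ (n - 1) * (deriv (stepProfile R j) t * t ^ p)) (Ioi 0) := by
    refine Integrable.mono' (hi.const_mul (R ^ (p + n - 1))) ?_ ?_
    · have := ((contDiff_stepProfile R j).continuous_deriv le_rfl).measurable
      exact Measurable.aestronglyMeasurable (by fun_prop)
    · filter_upwards [ae_restrict_mem measurableSet_Ioi] with t ht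
      have ht' : 0 < t := ht
      rw [Real.norm_of_nonneg
        (mul_nonneg (by positivity) (mul_nonneg (hnn t) (by positivity)))]
      exact hle t ht
  refine ⟨(integrable_comp_norm_iff hn
    (f := fun t => deriv (stepProfile R j) t * t ^ p)).mpr hint, ?_⟩
  rw [integral_comp_norm hn (fun t => deriv (stepProfile R j) t * t ^ p)]
  refine mul_le_mul_of_nonneg_left ?_ (unitSphereArea_pos hn).le
  calc _ ≤ ∫ t in Ioi (0 : ℝ), R ^ (p + n - 1) * deriv (stepProfile R j) t :=
        setIntegral_mono_on hint (hi.const_mul _) measurableSet_Ioi hle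
    _ = R ^ (p + n - 1) := by rw [integral_const_mul, h1, mul_one]

/-- The divergence theorem on the exterior of a sphere, with its indicator function smoothed. The
boundary term is an integral over a thin layer, where `|X| ≤ 1`. -/
theorem integral_stepProfile_mul_divergence_le {n : ℕ} (hn : 1 ≤ n) {p R : ℝ}
    (hp : p < -(n : ℝ)) (hR : 0 < R)
    {X : EuclideanSpace ℝ (Fin n) → EuclideanSpace ℝ (Fin n)} (hX : IsTestField X) (j : ℕ) :
    ∫ x, stepProfile R j ‖x‖ * divergence (fun y => ‖y‖ ^ p • X y) x
      ≤ unitSphereArea n * R ^ (p + n - 1) := by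
  set Y : EuclideanSpace ℝ (Fin n) → EuclideanSpace ℝ (Fin n) := fun y => ‖y‖ ^ p • X y with hYdef
  have hY : ContDiff ℝ 1 Y := hX.contDiff_smul (contDiffAt_rpow_of_pos p)
  have hYc : HasCompactSupport Y := hX.hasCompactSupport_smul _
  have hψY : ContDiff ℝ 1 fun y => stepProfile R j ‖y‖ • Y y :=
    contDiff_comp_norm_smul (fun r _ => (contDiff_stepProfile R j).contDiffAt) hY <| by
      filter_upwards [hX.eventuallyEq_zero] with y hy
      simp [hYdef, hy]
  have hψYc : HasCompactSupport fun y => stepProfile R j ‖y‖ • Y y :=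
    HasCompactSupport.smul_left (f := fun y => stepProfile R j ‖y‖) (f' := Y) hYc
  obtain ⟨hi, hle⟩ := integral_deriv_stepProfile_le hn hp hR j
  have hpt : ∀ x, stepProfile R j ‖x‖ * divergence Y x
      ≤ divergence (fun y => stepProfile R j ‖y‖ • Y y) x
        + deriv (stepProfile R j) ‖x‖ * ‖x‖ ^ p := fun x => by
    by_cases hx : x = 0
    · have hnear : (fun y => stepProfile R j ‖y‖ • Y y) =ᶠ[𝓝 x] fun _ => 0 := by
        rw [hx]
        filter_upwards [hX.eventuallyEq_zero] with y hy
        simp [hYdef, hy]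
      have h0 : divergence (fun y => stepProfile R j ‖y‖ • Y y) x = 0 := by
        simp [divergence, hnear.fderiv_eq]
      rw [h0, hx, norm_zero, stepProfile_of_le j hR.le, deriv_stepProfile_of_lt j hR]
      simp
    · have hx' : 0 < ‖x‖ := norm_pos_iff.mpr hx
      have hd := hasFDerivAt_comp_norm hx
        ((contDiff_stepProfile R j).differentiable one_ne_zero ‖x‖).hasDerivAt
      rw [divergence_smul hd.differentiableAt (hY.differentiable one_ne_zero x), hd.fderiv]
      have hin : -(‖x‖ * ‖x‖ ^ p) ≤ inner ℝ x (Y x) := by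
        have h1 := (abs_le.mp (abs_real_inner_le_norm x (Y x))).1
        have h2 : ‖Y x‖ ≤ ‖x‖ ^ p := by
          rw [hYdef, norm_smul, Real.norm_of_nonneg (by positivity)]
          exact mul_le_of_le_one_right (by positivity) (hX.norm_le_one x)
        nlinarith
      have hnn : 0 ≤ deriv (stepProfile R j) ‖x‖ / ‖x‖ :=
        div_nonneg (monotone_stepProfile R j).deriv_nonneg hx'.le
      have h3 := mul_le_mul_of_nonneg_left hin hnn
      have h4 : deriv (stepProfile R j) ‖x‖ / ‖x‖ * -(‖x‖ * ‖x‖ ^ p)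
          = -(deriv (stepProfile R j) ‖x‖ * ‖x‖ ^ p) := by
        field_simp
      simp only [smul_apply, innerSL_apply_apply, smul_eq_mul]
      linarith
  have hψint : Integrable fun x => stepProfile R j ‖x‖ * divergence Y x := by
    refine (integrable_divergence hY hYc).bdd_mul (c := 1)
      ((contDiff_stepProfile R j).continuous.comp continuous_norm).aestronglyMeasurable
      (ae_of_all _ fun x => norm_stepProfile_le_one R j _)
  calc _ ≤ ∫ x, (divergence (fun y => stepProfile R j ‖y‖ • Y y) x
        + deriv (stepProfile R j) ‖x‖ * ‖x‖ ^ p) :=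
        integral_mono hψint ((integrable_divergence hψY hψYc).add hi) hpt
    _ ≤ _ := by
      rw [integral_add (integrable_divergence hψY hψYc) hi,
        integral_divergence_eq_zero hψY hψYc, zero_add]
      exact hle

theorem weightedPerimeter_sphereExterior_le {n : ℕ} (hn : 1 ≤ n) {p R : ℝ} (hp : p < -(n : ℝ))
    (hR : 0 < R) :
    weightedPerimeter p (sphereExterior n R)
      ≤ ENNReal.ofReal (unitSphereArea n * R ^ (p + n - 1)) := by
  refine iSup₂_le fun X hX => ENNReal.ofReal_le_ofReal ?_
  set Y : EuclideanSpace ℝ (Fin n) → EuclideanSpace ℝ (Fin n) := fun y => ‖y‖ ^ p • X y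
  have hY : ContDiff ℝ 1 Y := hX.contDiff_smul (contDiffAt_rpow_of_pos p)
  have hYc : HasCompactSupport Y := hX.hasCompactSupport_smul _
  rw [← integral_indicator (measurableSet_sphereExterior n R)]
  refine le_of_tendsto' (tendsto_integral_of_dominated_convergence
    (F := fun j x => stepProfile R j ‖x‖ * divergence Y x) (fun x => ‖divergence Y x‖)
    (fun j => ?_) (integrable_divergence hY hYc).norm (fun j => ae_of_all _ fun x => ?_)
    (ae_of_all _ fun x => ?_)) fun j => integral_stepProfile_mul_divergence_le hn hp hR hX j
  · exact (((contDiff_stepProfile R j).continuous.comp continuous_norm).mul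
      (continuous_divergence hY)).aestronglyMeasurable
  · rw [norm_mul]
    exact mul_le_of_le_one_left (norm_nonneg _) (norm_stepProfile_le_one R j _)
  · by_cases hx : x ∈ sphereExterior n R
    · rw [indicator_of_mem hx]
      refine tendsto_const_nhds.congr' ?_
      filter_upwards [eventually_stepProfile_eq_one hx] with j hj
      rw [hj, one_mul]
    · rw [indicator_of_notMem hx]
      refine tendsto_const_nhds.congr fun j => ?_
      rw [stepProfile_of_le j (not_lt.mp hx), zero_mul]

/-! ### The radial test fields -/

/-- A smooth even bump function on `ℝ`, equal to `1` on `[-1, 1]` and supported in `[-2, 2]`. -/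
def bump : ContDiffBump (0 : ℝ) := ⟨1, 2, one_pos, one_lt_two⟩

theorem bump_eq_one {t : ℝ} (h : |t| ≤ 1) : bump t = 1 :=
  bump.one_of_mem_closedBall (by simpa [bump] using h)

theorem bump_eq_zero {t : ℝ} (h : 2 ≤ |t|) : bump t = 0 :=
  bump.zero_of_le_dist (by simpa [bump] using h)

theorem exists_abs_deriv_bump_le : ∃ C : ℝ, 0 ≤ C ∧ ∀ t, |deriv bump t| ≤ C := by
  obtain ⟨C, hC⟩ := (bump.hasCompactSupport.deriv).exists_bound_of_continuous
    (bump.contDiff.continuous_deriv (n := 1) le_rfl)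
  exact ⟨C, (abs_nonneg _).trans (hC 0), hC⟩

/-- The profile `g` of the test field `g(|x|) x` that approximates `-x / |x|`: the denominator is
regularised by `δ` and the support is cut down to `e^(-2K) ≤ |x| ≤ e^(2K)` by a bump function of
`log |x| / K`. On this scale the radial derivative of the cutoff is `O(1 / (K |x|))`. -/
noncomputable def calibrationProfile (δ K t : ℝ) : ℝ :=
  -(bump (Real.log t / K) / (t + δ))

theorem contDiffAt_calibrationProfile {δ : ℝ} (hδ : 0 < δ) (K : ℝ) {r : ℝ} (hr : 0 < r) :
    ContDiffAt ℝ 1 (calibrationProfile δ K) r := by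
  have h1 : ContDiffAt ℝ 1 (fun t => Real.log t / K) r :=
    (Real.contDiffAt_log.mpr hr.ne').div_const K
  exact ((bump.contDiff.contDiffAt.comp r h1).div (by fun_prop) (by positivity)).neg

theorem calibrationProfile_eq_zero {δ K t : ℝ} (hK : 0 < K) (h : 2 * K ≤ |Real.log t|) :
    calibrationProfile δ K t = 0 := by
  rw [calibrationProfile, bump_eq_zero, zero_div, neg_zero]
  rwa [abs_div, abs_of_pos hK, le_div_iff₀ hK]

theorem isTestField_calibration {n : ℕ} {δ K : ℝ} (hδ : 0 < δ) (hK : 0 < K) :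
    IsTestField fun x : EuclideanSpace ℝ (Fin n) => calibrationProfile δ K ‖x‖ • x := by
  have h0 : (fun x : EuclideanSpace ℝ (Fin n) => calibrationProfile δ K ‖x‖ • x) =ᶠ[𝓝 0] 0 := by
    filter_upwards [Metric.ball_mem_nhds (0 : EuclideanSpace ℝ (Fin n))
      (Real.exp_pos (-(2 * K)))] with x hx
    by_cases hx0 : x = 0
    · simp [hx0]
    · have hlog : Real.log ‖x‖ < -(2 * K) := by
        rw [Real.log_lt_iff_lt_exp (norm_pos_iff.mpr hx0)]
        simpa using hx
      have h2 : 2 * K ≤ |Real.log ‖x‖| := by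
        have := neg_le_abs (Real.log ‖x‖)
        linarith
      simp [calibrationProfile_eq_zero hK h2]
  refine ⟨contDiff_comp_norm_smul (fun r hr => contDiffAt_calibrationProfile hδ K hr)
    contDiff_id h0, ?_, notMem_tsupport_iff_eventuallyEq.mpr h0, fun x => ?_⟩
  · refine HasCompactSupport.intro (isCompact_closedBall 0 (Real.exp (2 * K))) fun x hx => ?_
    have hx' : Real.exp (2 * K) < ‖x‖ := by simpa using hx
    have h2 : 2 * K ≤ |Real.log ‖x‖| :=
      ((Real.le_log_iff_exp_le ((Real.exp_pos _).trans hx')).mpr hx'.le).trans (le_abs_self _)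
    rw [calibrationProfile_eq_zero hK h2, zero_smul]
  · have hpos : 0 < ‖x‖ + δ := by positivity
    rw [norm_smul, calibrationProfile, norm_neg, Real.norm_of_nonneg
      (div_nonneg bump.nonneg hpos.le), div_mul_eq_mul_div, div_le_one hpos]
    nlinarith [norm_nonneg x, bump.le_one (x := Real.log ‖x‖ / K)]

/-- The part of the divergence of a weighted test field that does not involve the derivative of
the cutoff. It tends to `(1 - (p + n)) t ^ (p - 1)` as `δ → 0` and `K → ∞`. -/
noncomputable def calibrationDensity (n : ℕ) (p δ K t : ℝ) : ℝ :=
  t ^ p * (bump (Real.log t / K) * (-(p + n) / (t + δ) + t / (t + δ) ^ 2))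

theorem calibrationDensity_nonneg {n : ℕ} {p δ K t : ℝ} (hp : p < -(n : ℝ)) (hδ : 0 < δ)
    (ht : 0 ≤ t) : 0 ≤ calibrationDensity n p δ K t := by
  have h : 0 ≤ -(p + n) := by linarith
  have := bump.nonneg (x := Real.log t / K)
  unfold calibrationDensity
  positivity

theorem measurable_calibrationDensity (n : ℕ) (p δ K : ℝ) :
    Measurable (calibrationDensity n p δ K) := by
  have := bump.continuous.measurable
  unfold calibrationDensity
  fun_prop

theorem divergence_calibration {n : ℕ} {p δ K : ℝ} (hδ : 0 < δ)
    {x : EuclideanSpace ℝ (Fin n)} (hx : x ≠ 0) :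
    divergence (fun y : EuclideanSpace ℝ (Fin n) => ‖y‖ ^ p • calibrationProfile δ K ‖y‖ • y) x
      = calibrationDensity n p δ K ‖x‖
        - ‖x‖ ^ p * (deriv bump (Real.log ‖x‖ / K) / (K * (‖x‖ + δ))) := by
  have ht : 0 < ‖x‖ := norm_pos_iff.mpr hx
  have hb : HasDerivAt (fun t => bump (Real.log t / K))
      (deriv bump (Real.log ‖x‖ / K) * (‖x‖⁻¹ / K)) ‖x‖ :=
    ((bump.contDiff (n := 1)).differentiable one_ne_zero _).hasDerivAt.comp ‖x‖
      ((Real.hasDerivAt_log ht.ne').div_const K)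
  have hg := (Real.hasDerivAt_rpow_const (p := p) (Or.inl ht.ne')).mul
    ((hb.div ((hasDerivAt_id ‖x‖).add_const δ) (by simp only [id]; positivity)).neg)
  simp_rw [smul_smul]
  refine (divergence_radial hx hg).trans ?_
  simp only [Pi.mul_apply, Pi.neg_apply, Pi.div_apply, id, calibrationDensity]
  rw [Real.rpow_sub_one ht.ne']
  have : ‖x‖ + δ ≠ 0 := by positivity
  -- For `K = 0` the junk value of the quotients is `0` on both sides.
  by_cases hK : K = 0
  · subst hK
    field_simp
    ring
  · field_simp
    ring

theorem calibrationDensity_le {n : ℕ} {p δ K C : ℝ} (hδ : 0 < δ) (hK : 0 < K)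
    (hC : ∀ t, |deriv bump t| ≤ C) {x : EuclideanSpace ℝ (Fin n)} (hx : x ≠ 0) :
    calibrationDensity n p δ K ‖x‖
      ≤ divergence
          (fun y : EuclideanSpace ℝ (Fin n) => ‖y‖ ^ p • calibrationProfile δ K ‖y‖ • y) x
        + C / (K * δ) * ‖x‖ ^ p := by
  have ht : 0 < ‖x‖ := norm_pos_iff.mpr hx
  rw [divergence_calibration hδ hx]
  have h : deriv bump (Real.log ‖x‖ / K) / (K * (‖x‖ + δ)) ≤ C / (K * δ) := by
    have h1 := (le_abs_self _).trans (hC (Real.log ‖x‖ / K))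
    have h0 := (abs_nonneg _).trans (hC 0)
    gcongr
    linarith
  have := mul_le_mul_of_nonneg_left h (by positivity : 0 ≤ ‖x‖ ^ p)
  linarith

theorem tendsto_calibrationDensity (n : ℕ) (p : ℝ) {t : ℝ} (ht : 0 < t) :
    Tendsto (fun k : ℕ => calibrationDensity n p (1 / ((k : ℝ) + 1)) (((k : ℝ) + 1) ^ 2) t) atTop
      (𝓝 ((1 - (p + n)) * t ^ (p - 1))) := by
  have h0 : Tendsto (fun k : ℕ => t + 1 / ((k : ℝ) + 1)) atTop (𝓝 t) := by
    simpa using tendsto_one_div_add_atTop_nhds_zero_nat.const_add t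
  have h1 : Tendsto (fun k : ℕ => t ^ p * (1 * (-(p + n) / (t + 1 / ((k : ℝ) + 1))
      + t / (t + 1 / ((k : ℝ) + 1)) ^ 2))) atTop
      (𝓝 (t ^ p * (1 * (-(p + n) / t + t / t ^ 2)))) :=
    (((tendsto_const_nhds.div h0 ht.ne').add
      (tendsto_const_nhds.div (h0.pow 2) (by positivity))).const_mul 1).const_mul _
  have h2 : t ^ p * (1 * (-(p + n) / t + t / t ^ 2)) = (1 - (p + n)) * t ^ (p - 1) := by
    rw [Real.rpow_sub_one ht.ne']
    field_simp
    ring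
  rw [h2] at h1
  refine h1.congr' ?_
  obtain ⟨N, hN⟩ := exists_nat_ge |Real.log t|
  filter_upwards [eventually_ge_atTop N] with k hk
  have hk' : (N : ℝ) ≤ k := by exact_mod_cast hk
  rw [calibrationDensity, bump_eq_one]
  rw [abs_div, abs_of_nonneg (by positivity : 0 ≤ ((k : ℝ) + 1) ^ 2), div_le_one (by positivity)]
  nlinarith [(Nat.cast_nonneg k : (0 : ℝ) ≤ k)]

/-! ### The calibration bound for the perimeter -/

/-- Testing the perimeter with a regularised field: the derivative of its cutoff costs at most
`C / (K δ)` times the volume. -/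
theorem lintegral_calibrationDensity_le {n : ℕ} (hn : 1 ≤ n) {p : ℝ} (hp : p < -(n : ℝ))
    {E : Set (EuclideanSpace ℝ (Fin n))} (hE : weightedVolume p E ≠ ⊤)
    {δ K C : ℝ} (hδ : 0 < δ) (hK : 0 < K) (hC : ∀ t, |deriv bump t| ≤ C) :
    ∫⁻ x in E, ENNReal.ofReal (calibrationDensity n p δ K ‖x‖)
      ≤ weightedPerimeter p E + ENNReal.ofReal (C / (K * δ)) * weightedVolume p E := by
  have : Nonempty (Fin n) := ⟨⟨0, hn⟩⟩
  have hC0 : 0 ≤ C := (abs_nonneg _).trans (hC 0)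
  set X : EuclideanSpace ℝ (Fin n) → EuclideanSpace ℝ (Fin n) :=
    fun x => calibrationProfile δ K ‖x‖ • x with hXdef
  have hX : IsTestField X := isTestField_calibration hδ hK
  have hdiv : Integrable (divergence fun y => ‖y‖ ^ p • X y) (volume.restrict E) :=
    (integrable_divergence (hX.contDiff_smul (contDiffAt_rpow_of_pos p))
      (hX.hasCompactSupport_smul _)).restrict
  have hw0 : 0 ≤ᵐ[volume.restrict E] fun x : EuclideanSpace ℝ (Fin n) => ‖x‖ ^ p :=
    ae_of_all _ fun x => by positivity
  have hw : Integrable (fun x : EuclideanSpace ℝ (Fin n) => ‖x‖ ^ p) (volume.restrict E) :=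
    (lintegral_ofReal_ne_top_iff_integrable
      (by fun_prop : Measurable fun x : EuclideanSpace ℝ (Fin n) => ‖x‖ ^ p).aestronglyMeasurable
      hw0).mp hE
  have hae : ∀ᵐ x ∂volume.restrict E, x ≠ (0 : EuclideanSpace ℝ (Fin n)) :=
    ae_restrict_of_ae (by simp [ae_iff])
  have hle : ∀ᵐ x ∂volume.restrict E, calibrationDensity n p δ K ‖x‖
      ≤ divergence (fun y => ‖y‖ ^ p • X y) x + C / (K * δ) * ‖x‖ ^ p := by
    filter_upwards [hae] with x hx using calibrationDensity_le hδ hK hC hx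
  calc _ ≤ ∫⁻ x in E, ENNReal.ofReal
          (divergence (fun y => ‖y‖ ^ p • X y) x + C / (K * δ) * ‖x‖ ^ p) :=
        lintegral_mono_ae (hle.mono fun x hx => ENNReal.ofReal_le_ofReal hx)
    _ = ENNReal.ofReal (∫ x in E, (divergence (fun y => ‖y‖ ^ p • X y) x
          + C / (K * δ) * ‖x‖ ^ p)) :=
        (ofReal_integral_eq_lintegral_ofReal (hdiv.add (hw.const_mul _)) (hle.mono fun x hx =>
          (calibrationDensity_nonneg hp hδ (norm_nonneg x)).trans hx)).symm
    _ ≤ ENNReal.ofReal (∫ x in E, divergence (fun y => ‖y‖ ^ p • X y) x)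
          + ENNReal.ofReal (C / (K * δ) * ∫ x in E, ‖x‖ ^ p) := by
        rw [integral_add hdiv (hw.const_mul _), integral_const_mul]
        exact ENNReal.ofReal_add_le
    _ ≤ _ := by
        rw [ENNReal.ofReal_mul (by positivity), ofReal_integral_eq_lintegral_ofReal hw hw0]
        exact add_le_add_left (le_iSup₂ (f := fun X (_ : IsTestField X) =>
          ENNReal.ofReal (∫ x in E, divergence (fun y => ‖y‖ ^ p • X y) x)) X hX) _

/-- The integrand on the left is `div (|x|^p X)` for `X = -x / |x|`, which is not a test field;
Fatou's lemma passes from its regularisations to the limit, without assuming that the limiting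
integral is finite. -/
theorem lintegral_le_weightedPerimeter {n : ℕ} (hn : 1 ≤ n) {p : ℝ} (hp : p < -(n : ℝ))
    {E : Set (EuclideanSpace ℝ (Fin n))} (hE : weightedVolume p E ≠ ⊤) :
    ∫⁻ x in E, ENNReal.ofReal ((1 - (p + n)) * ‖x‖ ^ (p - 1)) ≤ weightedPerimeter p E := by
  have : Nonempty (Fin n) := ⟨⟨0, hn⟩⟩
  obtain ⟨C, hC0, hC⟩ := exists_abs_deriv_bump_le
  set h : ℕ → EuclideanSpace ℝ (Fin n) → ℝ≥0∞ := fun k x =>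
    ENNReal.ofReal (calibrationDensity n p (1 / ((k : ℝ) + 1)) (((k : ℝ) + 1) ^ 2) ‖x‖) with hh
  have hmeas : ∀ k, Measurable (h k) := fun k =>
    ((measurable_calibrationDensity n p _ _).comp measurable_norm).ennreal_ofReal
  have hbound : ∀ k : ℕ, ∫⁻ x in E, h k x
      ≤ weightedPerimeter p E + ENNReal.ofReal (C * (1 / ((k : ℝ) + 1))) * weightedVolume p E :=
    fun k => by
      refine (lintegral_calibrationDensity_le hn hp hE (by positivity) (by positivity)
        hC).trans_eq ?_
      congr 3
      field_simp
  have hlim : Tendsto (fun k : ℕ => weightedPerimeter p E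
      + ENNReal.ofReal (C * (1 / ((k : ℝ) + 1))) * weightedVolume p E) atTop
      (𝓝 (weightedPerimeter p E)) := by
    have h1 := ENNReal.tendsto_ofReal
      (tendsto_one_div_add_atTop_nhds_zero_nat (𝕜 := ℝ).const_mul C)
    have h2 := (ENNReal.Tendsto.mul_const h1 (Or.inr hE)).const_add (weightedPerimeter p E)
    simpa using h2
  calc _ = ∫⁻ x in E, liminf (fun k => h k x) atTop := by
        refine lintegral_congr_ae (ae_restrict_of_ae ?_)
        have hae : ∀ᵐ x : EuclideanSpace ℝ (Fin n), x ≠ 0 := by simp [ae_iff]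
        filter_upwards [hae] with x hx
        exact (ENNReal.tendsto_ofReal
          (tendsto_calibrationDensity n p (norm_pos_iff.mpr hx))).liminf_eq.symm
    _ ≤ liminf (fun k => ∫⁻ x in E, h k x) atTop := lintegral_liminf_le hmeas
    _ ≤ liminf (fun k : ℕ => weightedPerimeter p E
          + ENNReal.ofReal (C * (1 / ((k : ℝ) + 1))) * weightedVolume p E) atTop :=
        liminf_le_liminf (Eventually.of_forall hbound)
    _ = weightedPerimeter p E := hlim.liminf_eq

/-! ### The bathtub principle -/

theorem setLIntegral_inter_add_diff₀ {α : Type*} [MeasurableSpace α] {μ : Measure α}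
    (f : α → ℝ≥0∞) (A : Set α) {B : Set α} (hB : NullMeasurableSet B μ) :
    ∫⁻ x in A ∩ B, f x ∂μ + ∫⁻ x in A \ B, f x ∂μ = ∫⁻ x in A, f x ∂μ := by
  rw [← lintegral_add_measure, Measure.restrict_inter_add_sdiff₀ A hB]

theorem setLIntegral_diff_eq_of_eq {α : Type*} [MeasurableSpace α] {μ : Measure α}
    {f : α → ℝ≥0∞} {A E : Set α} (hA : MeasurableSet A) (hE : NullMeasurableSet E μ)
    (hfA : ∫⁻ x in A, f x ∂μ ≠ ⊤) (hEA : ∫⁻ x in E, f x ∂μ = ∫⁻ x in A, f x ∂μ) :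
    ∫⁻ x in E \ A, f x ∂μ = ∫⁻ x in A \ E, f x ∂μ := by
  have h1 := setLIntegral_inter_add_diff₀ (μ := μ) f E hA.nullMeasurableSet
  have h2 := setLIntegral_inter_add_diff₀ (μ := μ) f A hE
  rw [hEA, ← h2, inter_comm E A] at h1
  refine (ENNReal.add_right_inj (ne_top_of_le_ne_top hfA ?_)).mp h1
  exact lintegral_mono_set inter_subset_left

/-- If `g / f` is below the level `c` exactly on `A`, then `A` minimises `∫ g` among the sets with
the same `∫ f`, and every minimiser contains `A` up to a null set. -/
theorem bathtub {α : Type*} [MeasurableSpace α] {μ : Measure α} {f g : α → ℝ≥0∞}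
    (hf : Measurable f) {A E : Set α} (hA : MeasurableSet A)
    (hE : NullMeasurableSet E μ) {c : ℝ≥0∞} (hfA : ∫⁻ x in A, f x ∂μ ≠ ⊤)
    (hgA : ∫⁻ x in A, g x ∂μ ≠ ⊤) (hEA : ∫⁻ x in E, f x ∂μ = ∫⁻ x in A, f x ∂μ)
    (hout : ∀ x ∉ A, c * f x ≤ g x) (hin : ∀ x ∈ A, g x < c * f x) :
    ∫⁻ x in A, g x ∂μ ≤ ∫⁻ x in E, g x ∂μ ∧
      (∫⁻ x in E, g x ∂μ ≤ ∫⁻ x in A, g x ∂μ → μ (A \ E) = 0) := by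
  have hdiff := setLIntegral_diff_eq_of_eq hA hE hfA hEA
  have hEd : NullMeasurableSet (E \ A) μ := hE.diff hA.nullMeasurableSet
  have hAd : NullMeasurableSet (A \ E) μ := hA.nullMeasurableSet.diff hE
  have hE1 := setLIntegral_inter_add_diff₀ (μ := μ) g E hA.nullMeasurableSet
  have hA1 := setLIntegral_inter_add_diff₀ (μ := μ) g A hE
  rw [inter_comm E A] at hE1
  have hlow : ∫⁻ x in A \ E, c * f x ∂μ ≤ ∫⁻ x in E \ A, g x ∂μ := by
    rw [lintegral_const_mul c hf, ← hdiff, ← lintegral_const_mul c hf]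
    exact lintegral_mono_ae ((ae_restrict_mem₀ hEd).mono fun x hx => hout x hx.2)
  have hinA : ∀ᵐ x ∂μ.restrict (A \ E), g x < c * f x :=
    (ae_restrict_mem₀ hAd).mono fun x hx => hin x hx.1
  refine ⟨?_, fun hle => ?_⟩
  · rw [← hE1, ← hA1]
    exact add_le_add le_rfl ((lintegral_mono_ae (hinA.mono fun x hx => hx.le)).trans hlow)
  · by_contra hne
    have hfin : ∫⁻ x in A ∩ E, g x ∂μ ≠ ⊤ :=
      ne_top_of_le_ne_top hgA (lintegral_mono_set inter_subset_left)
    rw [← hE1, ← hA1, ENNReal.add_le_add_iff_left hfin] at hle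
    have hlt : ∫⁻ x in A \ E, g x ∂μ < ∫⁻ x in A \ E, c * f x ∂μ :=
      lintegral_strict_mono (by simpa using hne) (hf.const_mul c).aemeasurable
        (ne_top_of_le_ne_top hgA (lintegral_mono_set sdiff_subset)) hinA
    exact absurd (hlow.trans hle) (not_le.mpr hlt)

/-! ### Exteriors of spheres are the unique minimisers -/

theorem lintegral_rpow_norm_sphereExterior {n : ℕ} (hn : 1 ≤ n) {p R : ℝ} (hp : p < -(n : ℝ))
    (hR : 0 < R) :
    ∫⁻ x in sphereExterior n R, ENNReal.ofReal (‖x‖ ^ p)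
      = ENNReal.ofReal (unitSphereArea n * (R ^ (p + n) / (-(p + n)))) := by
  rw [← integral_rpow_norm_sphereExterior hn hp hR,
    ofReal_integral_eq_lintegral_ofReal (integrableOn_rpow_norm_sphereExterior hn hp hR)
      (ae_of_all _ fun x => by positivity)]

theorem weightedVolume_sphereExterior {n : ℕ} (hn : 1 ≤ n) {p R : ℝ} (hp : p < -(n : ℝ))
    (hR : 0 < R) :
    weightedVolume p (sphereExterior n R)
      = ENNReal.ofReal (unitSphereArea n * (R ^ (p + n) / (-(p + n)))) :=
  lintegral_rpow_norm_sphereExterior hn hp hR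

theorem lintegral_divergence_sphereExterior {n : ℕ} (hn : 1 ≤ n) {p R : ℝ} (hp : p < -(n : ℝ))
    (hR : 0 < R) :
    ∫⁻ x in sphereExterior n R, ENNReal.ofReal ((1 - (p + n)) * ‖x‖ ^ (p - 1))
      = ENNReal.ofReal (unitSphereArea n * R ^ (p + n - 1)) := by
  have h1 : 0 < 1 - (p + n) := by linarith
  simp_rw [ENNReal.ofReal_mul h1.le]
  rw [lintegral_const_mul' _ _ ENNReal.ofReal_ne_top,
    lintegral_rpow_norm_sphereExterior hn (by linarith) hR, ← ENNReal.ofReal_mul h1.le]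
  congr 1
  rw [show p - 1 + n = p + n - 1 by ring, show -(p + n - 1) = 1 - (p + n) by ring]
  field_simp

/-- The bathtub principle for the densities `|x|^p` and `(1 - (p + n)) |x|^(p - 1)`: their ratio
decreases with `|x|`, so the exterior of a sphere minimises the integral of the second among the
sets of its weighted volume. The minimum is its weighted area. -/
theorem bathtub_sphereExterior {n : ℕ} (hn : 1 ≤ n) {p R : ℝ} (hp : p < -(n : ℝ))
    (hR : 0 < R) {E : Set (EuclideanSpace ℝ (Fin n))} (hE : NullMeasurableSet E volume)
    (hV : weightedVolume p E = weightedVolume p (sphereExterior n R)) :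
    ENNReal.ofReal (unitSphereArea n * R ^ (p + n - 1))
        ≤ ∫⁻ x in E, ENNReal.ofReal ((1 - (p + n)) * ‖x‖ ^ (p - 1)) ∧
      (∫⁻ x in E, ENNReal.ofReal ((1 - (p + n)) * ‖x‖ ^ (p - 1))
          ≤ ENNReal.ofReal (unitSphereArea n * R ^ (p + n - 1)) →
        volume (sphereExterior n R \ E) = 0) := by
  have h1 : 0 < 1 - (p + n) := by linarith
  have hp0 : p < 0 := hp.trans_le (by simp)
  have hA := lintegral_divergence_sphereExterior hn hp hR
  rw [← hA]
  -- The level is the value of `(1 - (p + n)) / |x|` on the sphere of radius `R`.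
  refine bathtub (c := ENNReal.ofReal ((1 - (p + n)) / R)) (by fun_prop)
    (measurableSet_sphereExterior n R) hE
    (weightedVolume_sphereExterior hn hp hR ▸ ENNReal.ofReal_ne_top :
      weightedVolume p (sphereExterior n R) ≠ ⊤)
    (hA ▸ ENNReal.ofReal_ne_top) hV (fun x hx => ?_) (fun x hx => ?_)
  · rw [← ENNReal.ofReal_mul (by positivity)]
    refine ENNReal.ofReal_le_ofReal ?_
    by_cases hx0 : x = 0
    · simp only [hx0, norm_zero, Real.zero_rpow hp0.ne, mul_zero]
      positivity
    · have hpos : 0 < ‖x‖ := norm_pos_iff.mpr hx0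
      rw [Real.rpow_sub_one hpos.ne', mul_div_assoc', div_mul_eq_mul_div]
      exact div_le_div_of_nonneg_left (by positivity) hpos (not_lt.mp hx)
  · have hx' : R < ‖x‖ := hx
    have hpos : 0 < ‖x‖ := hR.trans hx'
    rw [← ENNReal.ofReal_mul (by positivity), ENNReal.ofReal_lt_ofReal_iff (by positivity),
      Real.rpow_sub_one hpos.ne', mul_div_assoc', div_mul_eq_mul_div]
    exact div_lt_div_of_pos_left (by positivity) hR hx'

theorem weightedPerimeter_sphereExterior_le_of_volume_eq {n : ℕ} (hn : 1 ≤ n) {p R : ℝ}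
    (hp : p < -(n : ℝ)) (hR : 0 < R) {E : Set (EuclideanSpace ℝ (Fin n))}
    (hE : NullMeasurableSet E volume)
    (hV : weightedVolume p E = weightedVolume p (sphereExterior n R)) :
    weightedPerimeter p (sphereExterior n R) ≤ weightedPerimeter p E := by
  have hfin : weightedVolume p E ≠ ⊤ := by
    rw [hV, weightedVolume_sphereExterior hn hp hR]
    exact ENNReal.ofReal_ne_top
  exact (weightedPerimeter_sphereExterior_le hn hp hR).trans
    ((bathtub_sphereExterior hn hp hR hE hV).1.trans (lintegral_le_weightedPerimeter hn hp hfin))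

theorem ae_eq_sphereExterior_of_weightedPerimeter_le {n : ℕ} (hn : 1 ≤ n) {p R : ℝ}
    (hp : p < -(n : ℝ)) (hR : 0 < R) {E : Set (EuclideanSpace ℝ (Fin n))}
    (hE : NullMeasurableSet E volume)
    (hV : weightedVolume p E = weightedVolume p (sphereExterior n R))
    (hP : weightedPerimeter p E ≤ weightedPerimeter p (sphereExterior n R)) :
    E =ᵐ[volume] sphereExterior n R := by
  have : Nonempty (Fin n) := ⟨⟨0, hn⟩⟩
  have hAfin : weightedVolume p (sphereExterior n R) ≠ ⊤ := by
    rw [weightedVolume_sphereExterior hn hp hR]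
    exact ENNReal.ofReal_ne_top
  have hAE : volume (sphereExterior n R \ E) = 0 :=
    (bathtub_sphereExterior hn hp hR hE hV).2
      ((lintegral_le_weightedPerimeter hn hp (hV ▸ hAfin)).trans
        (hP.trans (weightedPerimeter_sphereExterior_le hn hp hR)))
  have hEA : volume (E \ sphereExterior n R) = 0 := by
    have h := setLIntegral_diff_eq_of_eq (measurableSet_sphereExterior n R) hE hAfin hV
    rw [setLIntegral_measure_zero _ _ hAE, lintegral_eq_zero_iff (by fun_prop)] at h
    have hae : ∀ᵐ x ∂volume.restrict (E \ sphereExterior n R),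
        x ≠ (0 : EuclideanSpace ℝ (Fin n)) := ae_restrict_of_ae (by simp [ae_iff])
    rw [← Measure.restrict_eq_zero, ← ae_eq_bot, ← eventually_false_iff_eq_bot]
    filter_upwards [h, hae] with x hx hx0
    have : 0 < ‖x‖ ^ p := Real.rpow_pos_of_pos (norm_pos_iff.mpr hx0) p
    simp only [Pi.zero_apply, ENNReal.ofReal_eq_zero] at hx
    linarith
  exact (ae_le_set.mpr hEA).antisymm (ae_le_set.mpr hAE)

/-! ### Radii and volumes -/

theorem weightedVolume_sphereExterior_pos {n : ℕ} (hn : 1 ≤ n) {p R : ℝ} (hp : p < -(n : ℝ))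
    (hR : 0 < R) : 0 < weightedVolume p (sphereExterior n R) := by
  have h1 : 0 < -(p + n) := by linarith
  have := unitSphereArea_pos hn
  rw [weightedVolume_sphereExterior hn hp hR, ENNReal.ofReal_pos]
  positivity

theorem existsUnique_weightedVolume_sphereExterior_eq {n : ℕ} (hn : 1 ≤ n) {p : ℝ}
    (hp : p < -(n : ℝ)) {V : ℝ≥0∞} (hV0 : 0 < V) (hV : V < ⊤) :
    ∃! R : ℝ, 0 < R ∧ weightedVolume p (sphereExterior n R) = V := by
  have ha : 0 < -(p + n) := by linarith
  have hω := unitSphereArea_pos hn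
  have hv : 0 < V.toReal := ENNReal.toReal_pos hV0.ne' hV.ne
  have hpn : p + n ≠ 0 := by linarith
  -- The equation `ω R^(p + n) / (-(p + n)) = V`, solved for `R^(p + n)`.
  have key : ∀ R : ℝ, 0 < R → (weightedVolume p (sphereExterior n R) = V ↔
      R ^ (p + n) = V.toReal * -(p + n) / unitSphereArea n) := fun R hR => by
    rw [weightedVolume_sphereExterior hn hp hR]
    nth_rewrite 1 [← ENNReal.ofReal_toReal hV.ne]
    rw [ENNReal.ofReal_eq_ofReal_iff (by positivity) hv.le, mul_div_assoc',
      div_eq_iff ha.ne', eq_div_iff hω.ne', mul_comm]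
  have hb : 0 < V.toReal * -(p + n) / unitSphereArea n := by positivity
  refine ⟨(V.toReal * -(p + n) / unitSphereArea n) ^ (p + n)⁻¹,
    ⟨by positivity, (key _ (by positivity)).mpr (Real.rpow_inv_rpow hb.le hpn)⟩, ?_⟩
  rintro R ⟨hR, hRV⟩
  rw [← (key R hR).mp hRV, Real.rpow_rpow_inv hR.le hpn]

end RadialDensity

theorem mainTheorem6 (n : ℕ) (hn : 1 ≤ n) (p : ℝ) (hp : p < -(n : ℝ)) :
    (∀ R : ℝ, 0 < R →
      0 < RadialDensity.weightedVolume p (RadialDensity.sphereExterior n R) ∧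
      RadialDensity.weightedVolume p (RadialDensity.sphereExterior n R) < ⊤ ∧
      RadialDensity.IsIsoperimetric p (RadialDensity.sphereExterior n R) ∧
      ∀ E : Set (EuclideanSpace ℝ (Fin n)), RadialDensity.IsIsoperimetric p E →
        RadialDensity.weightedVolume p E =
          RadialDensity.weightedVolume p (RadialDensity.sphereExterior n R) →
        E =ᵐ[volume] RadialDensity.sphereExterior n R) ∧
    (∀ V : ℝ≥0∞, 0 < V → V < ⊤ →
      ∃! R : ℝ, 0 < R ∧
        RadialDensity.weightedVolume p (RadialDensity.sphereExterior n R) = V) := by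
  refine ⟨fun R hR => ⟨RadialDensity.weightedVolume_sphereExterior_pos hn hp hR, ?_, ?_, ?_⟩,
    fun V hV0 hV => RadialDensity.existsUnique_weightedVolume_sphereExterior_eq hn hp hV0 hV⟩
  · rw [RadialDensity.weightedVolume_sphereExterior hn hp hR]
    exact ENNReal.ofReal_lt_top
  · exact ⟨(RadialDensity.measurableSet_sphereExterior n R).nullMeasurableSet, fun E hE hV =>
      RadialDensity.weightedPerimeter_sphereExterior_le_of_volume_eq hn hp hR hE hV⟩
  · intro E hE hV
    exact RadialDensity.ae_eq_sphereExterior_of_weightedPerimeter_le hn hp hR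
      hE.nullMeasurableSet hV (hE.perimeter_le _
        (RadialDensity.measurableSet_sphereExterior n R).nullMeasurableSet hV.symm)
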